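/- Let $m\ge 0$ be an integer, let $\mathbf{x}=(x_1,\dots,x_m)$ and $\mathbf{y}=(y_1,\dots,y_m)$ be indeterminates, and let $\mathcal{H}=\{z\in\mathbb{C}:\operatorname{Im} z>0\}$. A complex polynomial $f$ in finitely many variables is called *stable* if either $f$ is identically zero, or $f(\mathbf{z})\neq 0$ whenever all coordinates of $\mathbf{z}$ lie in $\mathcal{H}$. For $\kappa\in\mathbb{N}^m$ let $\mathbb{C}[\mathbf{x}]^{\le\kappa}$ be the space of all $f\in\mathbb{C}[\mathbf{x}]$ whose degree in $x_i$ is at most $\kappa(i)$ for every $i\in\{1,\dots,m\}$. **Theorem.** Let $\kappa\in\mathbb{N}^m$ and let $T:\mathbb{C}[\mathbf{x}]^{\le\kappa}\to\mathbb{C}[\mathbf{x}]$ be a $\mathbb{C}$-linear map. Then $T(f)$ is stable for every stable $f\in\mathbb{C}[\mathbf{x}]^{\le\kappa}$ if and only if at least one of the following holds: (a) there are a linear functional $\eta:\mathbb{C}[\mathbf{x}]^{\le\kappa}\to\mathbb{C}$ and a stable polynomial $p\in\mathbb{C}[\mathbf{x}]$ such that $T(f)=\eta(f)\cdot p$ for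 all $f\in\mathbb{C}[\mathbf{x}]^{\le\kappa}$; or (b) the polynomial $T\big((\mathbf{x}+\mathbf{y})^{\kappa}\big)$ is stable in $\mathbb{C}[\mathbf{x},\mathbf{y}]$, where $(\mathbf{x}+\mathbf{y})^{\kappa}=\prod_{i=1}^m (x_i+y_i)^{\kappa(i)}$ and $T$ acts on the $\mathbf{x}$ variables only, i.e. it is extended linearly by $T(\mathbf{x}^{\alpha}\mathbf{y}^{\beta})=T(\mathbf{x}^{\alpha})\,\mathbf{y}^{\beta}$. -/

import Mathlib

namespace StablePoly

open MvPolynomial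

/-- A complex polynomial is stable when it is the zero polynomial, or it has no zero all of whose
coordinates lie in the open upper half-plane. -/
def IsStable {σ : Type*} (f : MvPolynomial σ ℂ) : Prop :=
  f = 0 ∨ ∀ z : σ → ℂ, (∀ i, 0 < (z i).im) → eval z f ≠ 0

/-- `ℂ[x]^{≤κ}`: the polynomials whose degree in `x i` is at most `κ i`, for every `i`. -/
def degreeLE {m : ℕ} (κ : Fin m → ℕ) : Submodule ℂ (MvPolynomial (Fin m) ℂ) where
  carrier := {f | ∀ i, degreeOf i f ≤ κ i}
  zero_mem' := fun i => by simp
  add_mem' := fun {f g} hf hg i => (degreeOf_add_le i f g).trans (max_le (hf i) (hg i))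
  smul_mem' := fun c f hf i => by
    rw [smul_eq_C_mul]
    exact (degreeOf_C_mul_le f i c).trans (hf i)

theorem monomial_mem_degreeLE {m : ℕ} {κ : Fin m → ℕ} {α : Fin m →₀ ℕ} (h : ∀ i, α i ≤ κ i)
    (c : ℂ) : monomial α c ∈ degreeLE κ := fun i => by
  by_cases hc : c = 0
  · simp [hc]
  · rw [degreeOf_monomial_eq α i hc]
    exact h i

open Classical in
/-- The extension of `T : ℂ[x]^{≤κ} → ℂ[x]` to polynomials in `x` and `y`, the `y` variables being
treated as scalars: `x^α y^β ↦ T(x^α) y^β`, extended linearly. The `x` variables are indexed by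
`Sum.inl` and the `y` variables by `Sum.inr`. It is only meaningful on polynomials of degree at
most `κ` in the `x` variables; monomials that are not of this kind are sent to `0`. -/
noncomputable def extendToY {m : ℕ} {κ : Fin m → ℕ}
    (T : degreeLE κ →ₗ[ℂ] MvPolynomial (Fin m) ℂ) :
    MvPolynomial (Fin m ⊕ Fin m) ℂ →ₗ[ℂ] MvPolynomial (Fin m ⊕ Fin m) ℂ :=
  (basisMonomials (Fin m ⊕ Fin m) ℂ).constr ℂ fun d =>
    if h : ∀ i, (Finsupp.sumFinsuppEquivProdFinsupp d).1 i ≤ κ i then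
      rename Sum.inl
          (T ⟨monomial (Finsupp.sumFinsuppEquivProdFinsupp d).1 1, monomial_mem_degreeLE h 1⟩) *
        rename Sum.inr (monomial (Finsupp.sumFinsuppEquivProdFinsupp d).2 1)
    else 0

/-- The algebraic symbol `T((x + y)^κ)`, where `(x + y)^κ = ∏ i, (x i + y i)^{κ i}`. -/
noncomputable def symbol {m : ℕ} {κ : Fin m → ℕ}
    (T : degreeLE κ →ₗ[ℂ] MvPolynomial (Fin m) ℂ) : MvPolynomial (Fin m ⊕ Fin m) ℂ :=
  extendToY T (∏ i, (X (Sum.inl i) + X (Sum.inr i)) ^ κ i)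

end StablePoly

/-! Evaluating the symbol at `(x, y)` amounts to evaluating `T ((· + y)^κ)` at `x` (`eval_symbol`),
so both directions concern `T` on the powers `(· + y)^κ`.

Sufficiency is a Grace-type apolarity theorem. For fixed `x` in the upper half-plane, the functional
`Λ f = (T f)(x)` is nonzero on every `(· + y)^κ` with `y` in the upper half-plane, and should then
be nonzero on every nonvanishing `f`. The Cayley transform moves the question to the polydisc, where
Laguerre's theorem and Asano contraction give `sum_box_diag_ne_zero`. That result needs closed
discs, so one argument is contracted by a factor tending to `1`; in the limit `T f` may become
identically zero, and a root bound in place of Hurwitz's theorem shows that nothing else goes wrong.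

Necessity: if the symbol vanishes at some `(x, y)` in the upper half-plane, then `T` kills the
stable polynomial `(· + y)^κ`. Every `f` can be added to it with a small nonzero factor without
losing stability, so every `T f` is stable, and a linear space of stable polynomials has dimension
at most one. -/

namespace StablePoly

open Finset MvPolynomial

/-! ### Laguerre's theorem, Asano contraction and Grace's theorem on the unit disc. -/

/-- Averages, padded with zeros, stay in a convex set containing `0`. -/
theorem inv_smul_multiset_sum_mem {S : Set ℂ} (hS : Convex ℝ S) (h0 : (0 : ℂ) ∈ S)
    (s : Multiset ℂ) (hs : ∀ w ∈ s, w ∈ S) :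
    ∀ N : ℕ, 0 < N → Multiset.card s ≤ N → ((N : ℝ)⁻¹) • s.sum ∈ S := by
  induction s using Multiset.induction_on with
  | empty => intro N _ _; simpa using h0
  | cons a s ih =>
    intro N hN hc
    rw [Multiset.card_cons] at hc
    have ha := hs a (Multiset.mem_cons_self a s)
    have ih' := ih (fun w hw => hs w (Multiset.mem_cons_of_mem hw))
    rcases Nat.lt_or_ge 1 N with h1 | h1
    · have hm := ih' (N - 1) (by omega) (by omega)
      have hN1 : ((N - 1 : ℕ) : ℝ) = N - 1 := by rw [Nat.cast_sub (by omega)]; simp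
      have hN' : (1 : ℝ) < N := by exact_mod_cast h1
      have := hS ha hm (a := (N : ℝ)⁻¹) (b := 1 - (N : ℝ)⁻¹) (by positivity)
        (by rw [sub_nonneg]; exact inv_le_one_of_one_le₀ hN'.le) (by ring)
      convert this using 1
      rw [Multiset.sum_cons, smul_add, smul_smul, hN1]
      congr 2
      have : (N : ℝ) - 1 ≠ 0 := by linarith
      field_simp
    · have : N = 1 := by omega
      subst this
      have : s = 0 := Multiset.card_eq_zero.mp (by omega)
      subst this
      simpa using ha

/-- The image of the exterior of the closed unit disc, with `∞`, under `b ↦ 1 / (x - b)`. -/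
theorem convex_exterior_image {x : ℂ} (hx : ‖x‖ ≤ 1) :
    Convex ℝ {w : ℂ | (1 - Complex.normSq x) * Complex.normSq w + 2 * (x * w).re < 1} := by
  have hx' : 0 ≤ 1 - Complex.normSq x := by
    rw [Complex.normSq_eq_norm_sq]; nlinarith [norm_nonneg x]
  intro v hv w hw a b ha hb hab
  simp only [Set.mem_ofPred_eq] at *
  have key : Complex.normSq (a • v + b • w) ≤ a * Complex.normSq v + b * Complex.normSq w := by
    have hb' : b = 1 - a := by linarith
    subst hb'
    simp only [Complex.normSq_apply, Complex.add_re, Complex.add_im, Complex.real_smul,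
      Complex.mul_re, Complex.mul_im, Complex.ofReal_re, Complex.ofReal_im]
    nlinarith [mul_nonneg (mul_nonneg ha hb) (sq_nonneg (v.re - w.re)),
      mul_nonneg (mul_nonneg ha hb) (sq_nonneg (v.im - w.im))]
  have key2 : (x * (a • v + b • w)).re = a * (x * v).re + b * (x * w).re := by
    simp [Complex.real_smul]; ring
  rw [key2]
  have := mul_le_mul_of_nonneg_left key hx'
  rcases ha.eq_or_lt with h | h
  · subst h
    obtain rfl : b = 1 := by linarith
    linarith
  · have := mul_lt_mul_of_pos_left hv h
    have := mul_le_mul_of_nonneg_left hw.le hb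
    linarith

/-- With `w = 1 / (x - b)` one has `b w = x w - 1`, so `|b| > 1` reads `|x w - 1| > |w|`; squaring
gives the inequality. -/
theorem inv_sub_mem_exterior_image_iff {x b : ℂ} (hb : x ≠ b) :
    (1 - Complex.normSq x) * Complex.normSq (x - b)⁻¹ + 2 * (x * (x - b)⁻¹).re < 1 ↔ 1 < ‖b‖ := by
  have hne : x - b ≠ 0 := sub_ne_zero.mpr hb
  have hpos : 0 < Complex.normSq (x - b) := Complex.normSq_pos.mpr hne
  have h1 : (x * (x - b)⁻¹).re = (x * (starRingEnd ℂ) (x - b)).re / Complex.normSq (x - b) := by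
    rw [Complex.inv_def, ← mul_assoc, Complex.re_mul_ofReal]; rfl
  rw [h1, Complex.normSq_inv]
  have h2 : (1 - Complex.normSq x) * (Complex.normSq (x - b))⁻¹
      + 2 * ((x * (starRingEnd ℂ) (x - b)).re / Complex.normSq (x - b))
      = ((1 - Complex.normSq x) + 2 * (x * (starRingEnd ℂ) (x - b)).re) /
        Complex.normSq (x - b) := by field_simp
  rw [h2, div_lt_one hpos]
  have h3 : (1 < ‖b‖) ↔ 1 < Complex.normSq b := by
    rw [Complex.normSq_eq_norm_sq]
    exact (one_lt_sq_iff₀ (norm_nonneg b)).symm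
  rw [h3]
  simp only [Complex.normSq_apply, Complex.mul_re, Complex.conj_re, Complex.conj_im,
    Complex.sub_re, Complex.sub_im]
  constructor <;> intro h <;> nlinarith

/-- Laguerre's theorem on polar derivatives, for the unit disc. -/
theorem polar_derivative_ne_zero {N : ℕ} (hN : 0 < N) {p : Polynomial ℂ} (hd : p.natDegree ≤ N)
    (hp : ∀ x : ℂ, ‖x‖ ≤ 1 → p.eval x ≠ 0) {x u : ℂ} (hx : ‖x‖ ≤ 1) (hu : ‖u‖ ≤ 1) :
    p.eval x + (u - x) * (p.derivative.eval x / N) ≠ 0 := by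
  intro h
  have hpx := hp x hx
  have hN' : (N : ℂ) ≠ 0 := by exact_mod_cast hN.ne'
  have hxu : x ≠ u := by
    rintro rfl
    simp [hpx] at h
  have hq : p.derivative.eval x / p.eval x = N * (x - u)⁻¹ := by
    have : x - u ≠ 0 := sub_ne_zero.mpr hxu
    field_simp
    field_simp at h
    linear_combination -h
  rw [Polynomial.Splits.eval_derivative_div_eval_of_ne_zero (IsAlgClosed.splits p) hpx] at hq
  -- `p'/p` is the sum of `1 / (x - b)` over the roots `b`. If `p` has degree below `N`, the missing
  -- roots lie at infinity and contribute the padding zeros.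
  have hmem := inv_smul_multiset_sum_mem (convex_exterior_image hx) (by simp)
    (p.roots.map fun z => 1 / (x - z)) (by
      intro w hw
      obtain ⟨b, hb, rfl⟩ := Multiset.mem_map.mp hw
      have hb0 : p.eval b = 0 := (Polynomial.mem_roots'.mp hb).2
      have hb1 : 1 < ‖b‖ := by
        by_contra hcon
        exact hp b (not_lt.mp hcon) hb0
      have hxb : x ≠ b := by rintro rfl; exact hpx hb0
      rw [one_div]
      exact (inv_sub_mem_exterior_image_iff hxb).mpr hb1) N hN
    (by rw [Multiset.card_map]; exact (Polynomial.card_roots' p).trans hd)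
  rw [hq] at hmem
  have e : (N : ℝ)⁻¹ • ((N : ℂ) * (x - u)⁻¹) = (x - u)⁻¹ := by
    rw [Complex.real_smul]; push_cast; field_simp
  rw [e] at hmem
  have := (inv_sub_mem_exterior_image_iff hxu).mp hmem
  linarith

/-- Laguerre's theorem in coefficients, for degree `n + 1`: one of the `n + 1` symmetric copies of
`x` is renamed `u`, so `x ^ j` becomes `(1 - j/(n+1)) x ^ j + (j/(n+1)) u x ^ (j-1)`. -/
theorem polarize_ne_zero {n : ℕ} {a : ℕ → ℂ}
    (ha : ∀ x : ℂ, ‖x‖ ≤ 1 → ∑ j ∈ range (n + 2), a j * x ^ j ≠ 0)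
    {x u : ℂ} (hx : ‖x‖ ≤ 1) (hu : ‖u‖ ≤ 1) :
    ∑ j ∈ range (n + 1), a j * (1 - j / (n + 1)) * x ^ j
      + u * ∑ j ∈ range (n + 1), a (j + 1) * ((j + 1) / (n + 1)) * x ^ j ≠ 0 := by
  set p : Polynomial ℂ := ∑ j ∈ range (n + 2), Polynomial.monomial j (a j) with hpdef
  have hev : ∀ x, p.eval x = ∑ j ∈ range (n + 2), a j * x ^ j := fun x => by
    simp [hpdef, Polynomial.eval_finsetSum]
  have hd : p.natDegree ≤ n + 1 := by
    refine Polynomial.natDegree_sum_le_of_forall_le _ _ fun j hj => ?_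
    exact (Polynomial.natDegree_monomial_le _).trans (by have := mem_range.mp hj; omega)
  have hder : p.derivative.eval x = ∑ j ∈ range (n + 1), a (j + 1) * (j + 1) * x ^ j := by
    simp only [hpdef, Polynomial.derivative_sum, Polynomial.eval_finsetSum,
      Polynomial.derivative_monomial, Polynomial.eval_monomial]
    rw [sum_range_succ']
    simp
  have h := polar_derivative_ne_zero (Nat.succ_pos n) hd (fun x hx => by rw [hev]; exact ha x hx)
    hx hu
  convert h using 1
  rw [hder, hev]
  have hn : (n : ℂ) + 1 ≠ 0 := by exact_mod_cast n.succ_ne_zero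
  have e1 : ∑ j ∈ range (n + 1), a j * (1 - j / (n + 1)) * x ^ j
      = ∑ j ∈ range (n + 2), a j * x ^ j
        - x * ∑ j ∈ range (n + 1), a (j + 1) * ((j + 1) / (n + 1)) * x ^ j := by
    have : ∑ j ∈ range (n + 1), a j * (1 - j / (n + 1)) * x ^ j
        = ∑ j ∈ range (n + 2), a j * (1 - j / (n + 1)) * x ^ j := by
      rw [sum_range_succ _ (n + 1)]
      push_cast
      rw [div_self hn]; simp
    rw [this, eq_sub_iff_add_eq, mul_sum]
    have h0 : ∑ j ∈ range (n + 2), a j * (j / (n + 1)) * x ^ j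
        = ∑ j ∈ range (n + 1), x * (a (j + 1) * ((j + 1) / (n + 1)) * x ^ j) := by
      rw [sum_range_succ']
      simp only [Nat.cast_zero, zero_div, mul_zero, zero_mul, add_zero]
      refine sum_congr rfl fun j _ => ?_
      push_cast; ring
    rw [← h0, ← sum_add_distrib]
    exact sum_congr rfl fun j _ => by ring
  have e2 : (∑ j ∈ range (n + 1), a (j + 1) * (j + 1) * x ^ j) / ((n + 1 : ℕ) : ℂ)
      = ∑ j ∈ range (n + 1), a (j + 1) * ((j + 1) / (n + 1)) * x ^ j := by
    rw [sum_div]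
    refine sum_congr rfl fun j _ => ?_
    push_cast; field_simp
  rw [e1, e2]; ring

/-- Asano contraction. -/
theorem asano_contraction {a b c d : ℂ}
    (h : ∀ u v : ℂ, ‖u‖ ≤ 1 → ‖v‖ ≤ 1 → a + u * b + v * (c + u * d) ≠ 0) : a + d ≠ 0 := by
  intro had
  obtain rfl : d = -a := by linear_combination had
  have ha : a ≠ 0 := by simpa using h 0 0 (by simp) (by simp)
  -- one of the two roots of `a + (b + c) t - a t²` lies in the closed disc
  obtain ⟨s, hs⟩ := IsAlgClosed.exists_eq_mul_self ((b + c) ^ 2 + 4 * a * a)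
  set t₁ := ((b + c) + s) / (2 * a)
  set t₂ := ((b + c) - s) / (2 * a)
  have h1 : a + t₁ * b + t₁ * (c + t₁ * -a) = 0 := by
    simp only [t₁]; field_simp; linear_combination hs
  have h2 : a + t₂ * b + t₂ * (c + t₂ * -a) = 0 := by
    simp only [t₂]; field_simp; linear_combination hs
  have hprod : t₁ * t₂ = -1 := by
    simp only [t₁, t₂]; field_simp; linear_combination hs
  have hn : ‖t₁‖ * ‖t₂‖ = 1 := by rw [← norm_mul, hprod]; simp
  rcases le_total ‖t₁‖ 1 with h' | h'
  · exact h _ _ h' h' h1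
  · have : ‖t₂‖ ≤ 1 := by nlinarith [norm_nonneg t₂]
    exact h _ _ this this h2

/-- A two-variable form of Grace's theorem. -/
theorem sum_diag_div_choose_ne_zero (n : ℕ) : ∀ c : ℕ → ℕ → ℂ,
    (∀ x z : ℂ, ‖x‖ ≤ 1 → ‖z‖ ≤ 1 →
      ∑ j ∈ range (n + 1), ∑ k ∈ range (n + 1), c j k * x ^ j * z ^ k ≠ 0) →
    ∑ k ∈ range (n + 1), c k k / (n.choose k : ℂ) ≠ 0 := by
  induction n with
  | zero => intro c h; simpa using h 0 0 (by simp) (by simp)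
  | succ n ih =>
    intro c h
    have hn : (n : ℂ) + 1 ≠ 0 := by exact_mod_cast n.succ_ne_zero
    -- One copy `u` is split off `x` and one copy `v` off `z`. Asano contraction then adds the
    -- coefficients of `1` and `u v`, leaving an array of degree `n`.
    have h' := ih (fun j k => c j k * (1 - j / (n + 1)) * (1 - k / (n + 1)) +
      c (j + 1) (k + 1) * ((j + 1) / (n + 1)) * ((k + 1) / (n + 1))) (fun x z hx hz => by
        have key := asano_contraction
          (a := ∑ j ∈ range (n + 1), ∑ k ∈ range (n + 1),
            c j k * (1 - j / (n + 1)) * (1 - k / (n + 1)) * x ^ j * z ^ k)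
          (b := ∑ j ∈ range (n + 1), ∑ k ∈ range (n + 1),
            c (j + 1) k * ((j + 1) / (n + 1)) * (1 - k / (n + 1)) * x ^ j * z ^ k)
          (c := ∑ j ∈ range (n + 1), ∑ k ∈ range (n + 1),
            c j (k + 1) * (1 - j / (n + 1)) * ((k + 1) / (n + 1)) * x ^ j * z ^ k)
          (d := ∑ j ∈ range (n + 1), ∑ k ∈ range (n + 1),
            c (j + 1) (k + 1) * ((j + 1) / (n + 1)) * ((k + 1) / (n + 1)) * x ^ j * z ^ k)
          (fun u v hu hv => by
            have := polarize_ne_zero (n := n)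
              (a := fun k => ∑ j ∈ range (n + 1), c j k * (1 - j / (n + 1)) * x ^ j
                + u * ∑ j ∈ range (n + 1), c (j + 1) k * ((j + 1) / (n + 1)) * x ^ j)
              (fun z hz => by
                have := polarize_ne_zero (n := n)
                  (a := fun j => ∑ k ∈ range (n + 2), c j k * z ^ k)
                  (fun x hx => by
                    convert h x z hx hz using 1
                    refine sum_congr rfl fun j _ => ?_
                    rw [sum_mul]
                    exact sum_congr rfl fun k _ => by ring) hx hu
                convert this using 1
                simp only [add_mul, sum_add_distrib, sum_mul, mul_sum]
                rw [sum_comm]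
                congr 1
                · exact sum_congr rfl fun j _ => sum_congr rfl fun k _ => by ring
                · rw [sum_comm]
                  exact sum_congr rfl fun j _ => sum_congr rfl fun k _ => by ring) hz hv
            convert this using 1
            simp only [add_mul, mul_add, sum_add_distrib, sum_mul, mul_sum]
            have e : ∀ g₁ g₂ : ℕ → ℕ → ℂ, (∀ j k, g₁ j k = g₂ k j) →
                ∑ j ∈ range (n + 1), ∑ k ∈ range (n + 1), g₁ j k
                  = ∑ k ∈ range (n + 1), ∑ j ∈ range (n + 1), g₂ k j := fun g₁ g₂ hg => by
              rw [sum_comm]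
              exact sum_congr rfl fun k _ => sum_congr rfl fun j _ => hg j k
            congr 1
            · congr 1
              · exact e _ _ fun j k => by ring
              · exact e _ _ fun j k => by ring
            · congr 1
              · exact e _ _ fun j k => by ring
              · exact e _ _ fun j k => by ring)
        convert key using 1
        simp only [add_mul, sum_add_distrib])
    convert h' using 1
    -- One factor `1 - k/(n+1)` turns `1 / n.choose k` into `1 / (n+1).choose k`, and likewise after
    -- the shift in `w2`. The factors left over, `1 - k/(n+1)` and `k/(n+1)`, add up to `1`.
    have w1 : ∑ k ∈ range (n + 1), c k k * (1 - k / (n + 1)) * (1 - k / (n + 1)) / (n.choose k : ℂ)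
        = ∑ k ∈ range (n + 2), c k k * (1 - k / (n + 1)) / ((n + 1).choose k : ℂ) := by
      rw [sum_range_succ _ (n + 1)]
      push_cast
      rw [div_self hn]
      simp only [sub_self, mul_zero, zero_div, add_zero]
      refine sum_congr rfl fun k hk => ?_
      have hk' : k ≤ n := by have := mem_range.mp hk; omega
      have h1 : (n.choose k : ℂ) ≠ 0 := by exact_mod_cast (Nat.choose_pos hk').ne'
      have h2 : ((n + 1).choose k : ℂ) ≠ 0 := by
        exact_mod_cast (Nat.choose_pos (hk'.trans n.le_succ)).ne'
      have h3 : (n.choose k : ℂ) * (n + 1) = (n + 1).choose k * (n + 1 - k) := by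
        have := Nat.choose_mul_succ_eq n k
        have e : ((n + 1 - k : ℕ) : ℂ) = (n : ℂ) + 1 - k := by
          rw [Nat.cast_sub (by omega)]; push_cast; ring
        rw [← e]; exact_mod_cast this
      have h4 : (1 - (k : ℂ) / (n + 1)) = n.choose k / (n + 1).choose k := by
        field_simp
        linear_combination -h3
      rw [h4]
      field_simp
    have w2 : ∑ k ∈ range (n + 1), c (k + 1) (k + 1) * ((k + 1) / (n + 1)) * ((k + 1) / (n + 1))
          / (n.choose k : ℂ)
        = ∑ k ∈ range (n + 2), c k k * (k / (n + 1)) / ((n + 1).choose k : ℂ) := by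
      rw [sum_range_succ' _ (n + 1)]
      simp only [Nat.cast_zero, zero_div, mul_zero, add_zero]
      refine sum_congr rfl fun k hk => ?_
      have hk' : k ≤ n := by have := mem_range.mp hk; omega
      have h1 : (n.choose k : ℂ) ≠ 0 := by exact_mod_cast (Nat.choose_pos hk').ne'
      have h2 : ((n + 1).choose (k + 1) : ℂ) ≠ 0 := by
        exact_mod_cast (Nat.choose_pos (Nat.succ_le_succ hk')).ne'
      have h3 : ((n : ℂ) + 1) * n.choose k = (n + 1).choose (k + 1) * (k + 1) := by
        exact_mod_cast Nat.add_one_mul_choose_eq n k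
      have h4 : ((k : ℂ) + 1) / (n + 1) = n.choose k / (n + 1).choose (k + 1) := by
        field_simp
        linear_combination -h3
      push_cast
      rw [h4]
      field_simp
    rw [sum_congr rfl fun k _ => add_div _ _ _, sum_add_distrib, w1, w2, ← sum_add_distrib]
    exact sum_congr rfl fun k _ => by ring

/-! ### Grace's theorem on the polydisc, and a root bound. -/

/-- The exponents `α ≤ κ`. -/
def box {m : ℕ} (κ : Fin m → ℕ) : Finset (Fin m → ℕ) :=
  Fintype.piFinset fun i => range (κ i + 1)

theorem mem_box {m : ℕ} {κ α : Fin m → ℕ} : α ∈ box κ ↔ ∀ i, α i ≤ κ i := by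
  simp [box]

theorem sum_box_succ {M : Type*} [AddCommMonoid M] {m : ℕ} (κ : Fin (m + 1) → ℕ)
    (f : (Fin (m + 1) → ℕ) → M) :
    ∑ α ∈ box κ, f α = ∑ k ∈ range (κ 0 + 1), ∑ β ∈ box (Fin.tail κ), f (Fin.cons k β) := by
  rw [← sum_product']
  refine sum_nbij' (fun α => (α 0, Fin.tail α)) (fun p => Fin.cons p.1 p.2) ?_ ?_ ?_ ?_ ?_
  · intro α hα
    rw [mem_box] at hα
    simp only [mem_product, mem_range, mem_box]
    exact ⟨Nat.lt_succ_of_le (hα 0), fun i => hα i.succ⟩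
  · rintro ⟨k, β⟩ h
    simp only [mem_product, mem_range, mem_box] at h
    rw [mem_box]
    exact Fin.cases (by simpa using Nat.le_of_lt_succ h.1) (fun i => by simpa [Fin.tail] using h.2 i)
  · intro α _; simp
  · intro p _; simp
  · intro α _; simp

/-- A multivariate form of Grace's theorem for the unit polydisc. -/
theorem sum_box_diag_ne_zero : ∀ (m : ℕ) (κ : Fin m → ℕ) (c : (Fin m → ℕ) → (Fin m → ℕ) → ℂ),
    (∀ x z : Fin m → ℂ, (∀ i, ‖x i‖ ≤ 1) → (∀ i, ‖z i‖ ≤ 1) →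
      ∑ α ∈ box κ, ∑ β ∈ box κ, c α β * (∏ i, x i ^ α i) * (∏ i, z i ^ β i) ≠ 0) →
    ∑ α ∈ box κ, c α α / ∏ i, ((κ i).choose (α i) : ℂ) ≠ 0 := by
  intro m
  induction m with
  | zero =>
    intro κ c h
    have hb : box κ = {Fin.elim0} := by
      ext α
      simp only [mem_box, mem_singleton]
      exact ⟨fun _ => funext fun i => i.elim0, fun _ i => i.elim0⟩
    simpa [hb] using h Fin.elim0 Fin.elim0 (fun i => i.elim0) (fun i => i.elim0)
  | succ m ih =>
    intro κ c h
    -- Coordinate `0` is contracted with the other variables frozen; the contracted array satisfies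
    -- the hypothesis in `m` variables.
    have h' := ih (Fin.tail κ) (fun α β => ∑ k ∈ range (κ 0 + 1),
      c (Fin.cons k α) (Fin.cons k β) / ((κ 0).choose k : ℂ)) (fun x z hx hz => by
        have := sum_diag_div_choose_ne_zero (κ 0)
          (fun j k => ∑ α ∈ box (Fin.tail κ), ∑ β ∈ box (Fin.tail κ),
            c (Fin.cons j α) (Fin.cons k β) * (∏ i, x i ^ α i) * (∏ i, z i ^ β i))
          (fun x0 z0 hx0 hz0 => by
            have := h (Fin.cons x0 x) (Fin.cons z0 z)
              (Fin.cases (by simpa using hx0) (by simpa using hx))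
              (Fin.cases (by simpa using hz0) (by simpa using hz))
            convert this using 1
            simp only [sum_box_succ, Fin.prod_univ_succ, Fin.cons_zero, Fin.cons_succ]
            refine sum_congr rfl fun j _ => ?_
            rw [sum_comm]
            refine sum_congr rfl fun k _ => ?_
            simp only [sum_mul]
            refine sum_congr rfl fun α _ => ?_
            refine sum_congr rfl fun β _ => ?_
            ring)
        convert this using 1
        simp only [sum_mul, sum_div]
        rw [sum_comm]
        conv_rhs => rw [sum_comm]
        conv_lhs => rw [sum_comm]
        refine sum_congr rfl fun α _ => ?_
        rw [sum_comm]
        refine sum_congr rfl fun β _ => ?_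
        refine sum_congr rfl fun k _ => ?_
        ring)
    convert h' using 1
    rw [sum_box_succ, sum_comm]
    refine sum_congr rfl fun α _ => ?_
    rw [sum_div]
    refine sum_congr rfl fun k _ => ?_
    simp only [Fin.prod_univ_succ, Fin.cons_zero, Fin.cons_succ, Fin.tail]
    rw [div_div]

/-- Each root satisfies `|a| ≥ ρ`, hence `|1 - a| ≤ 1 + |a| ≤ |a| (1 + 1/ρ)`. The bound depends only
on `D` and `ρ`, so it survives limits and does the work of Hurwitz's theorem. -/
theorem norm_eval_le_of_ne_zero {p : Polynomial ℂ} {D : ℕ} (hD : p.natDegree ≤ D) {ρ : ℝ}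
    (hρ : 0 < ρ) (hp : ∀ t : ℂ, ‖t‖ < ρ → p.eval t ≠ 0) :
    ‖p.eval 1‖ ≤ ‖p.eval 0‖ * (1 + 1 / ρ) ^ D := by
  have hs := IsAlgClosed.splits p
  have hev : ∀ t : ℂ, p.eval t = p.leadingCoeff * (p.roots.map fun a => t - a).prod := fun t => by
    conv_lhs => rw [hs.eq_prod_roots]
    simp [Polynomial.eval_multiset_prod, Multiset.map_map]
  have hroot : ∀ a ∈ p.roots, ρ ≤ ‖a‖ := fun a ha => by
    by_contra hcon
    exact hp a (not_le.mp hcon) (Polynomial.mem_roots'.mp ha).2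
  have key : ∀ s : Multiset ℂ, (∀ a ∈ s, ρ ≤ ‖a‖) →
      ‖(s.map fun a => (1 : ℂ) - a).prod‖
        ≤ ‖(s.map fun a => (0 : ℂ) - a).prod‖ * (1 + 1 / ρ) ^ (Multiset.card s) := by
    intro s
    induction s using Multiset.induction_on with
    | empty => simp
    | cons a s ih =>
      intro h
      have ih' := ih fun b hb => h b (Multiset.mem_cons_of_mem hb)
      have ha := h a (Multiset.mem_cons_self a s)
      have h1 : ‖(1 : ℂ) - a‖ ≤ ‖(0 : ℂ) - a‖ * (1 + 1 / ρ) := by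
        have : 1 ≤ ‖a‖ * (1 / ρ) := by
          rw [mul_one_div, le_div_iff₀ hρ]; linarith
        calc ‖(1 : ℂ) - a‖ ≤ 1 + ‖a‖ := by simpa using norm_sub_le (1 : ℂ) a
          _ ≤ _ := by rw [zero_sub, norm_neg]; linarith
      rw [Multiset.map_cons, Multiset.map_cons, Multiset.prod_cons, Multiset.prod_cons,
        norm_mul, norm_mul, Multiset.card_cons, pow_succ]
      calc _ ≤ (‖(0 : ℂ) - a‖ * (1 + 1 / ρ)) *
            (‖(s.map fun a => (0 : ℂ) - a).prod‖ * (1 + 1 / ρ) ^ (Multiset.card s)) :=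
            mul_le_mul h1 ih' (norm_nonneg _) (by positivity)
        _ = _ := by ring
  rw [hev, hev, norm_mul, norm_mul, mul_assoc]
  refine mul_le_mul_of_nonneg_left ((key _ hroot).trans ?_) (norm_nonneg _)
  refine mul_le_mul_of_nonneg_left ?_ (norm_nonneg _)
  refine pow_le_pow_right₀ ?_ ((Polynomial.card_roots' p).trans hD)
  have : 0 < 1 / ρ := by positivity
  linarith

/-! ### Polynomials of bounded degree and evaluation of the symbol. -/

theorem prod_add_pow {R : Type*} [CommSemiring R] {m : ℕ} (κ : Fin m → ℕ) (u v : Fin m → R) :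
    ∏ i, (u i + v i) ^ κ i
      = ∑ α ∈ box κ, ∏ i, (u i ^ α i * v i ^ (κ i - α i) * ((κ i).choose (α i) : R)) := by
  simp only [add_pow]
  rw [prod_univ_sum]
  rfl

theorem degreeOf_X_add_C_pow_le {m : ℕ} (i j : Fin m) (a : ℂ) (k : ℕ) :
    degreeOf j ((X i + C a : MvPolynomial (Fin m) ℂ) ^ k) ≤ if i = j then k else 0 := by
  refine (degreeOf_pow_le j _ k).trans ?_
  have h : degreeOf j (X i + C a : MvPolynomial (Fin m) ℂ) ≤ if i = j then 1 else 0 := by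
    refine (degreeOf_add_le j _ _).trans ?_
    rw [degreeOf_C, degreeOf_X]
    simp [eq_comm]
  refine (Nat.mul_le_mul_left k h).trans ?_
  split_ifs <;> simp

theorem prod_linear_mem_degreeLE {m : ℕ} {κ k l : Fin m → ℕ} (h : ∀ i, k i + l i ≤ κ i)
    (a b : Fin m → ℂ) : ∏ i, ((X i + C (a i)) ^ k i * (X i + C (b i)) ^ l i) ∈ degreeLE κ := by
  intro j
  refine (degreeOf_prod_le j univ _).trans ?_
  calc ∑ i, degreeOf j ((X i + C (a i) : MvPolynomial (Fin m) ℂ) ^ k i * (X i + C (b i)) ^ l i)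
      ≤ ∑ i, if i = j then κ i else 0 := by
        refine sum_le_sum fun i _ => (degreeOf_mul_le j _ _).trans ?_
        refine (add_le_add (degreeOf_X_add_C_pow_le i j _ _)
          (degreeOf_X_add_C_pow_le i j _ _)).trans ?_
        have := h i
        split_ifs
        · exact this
        · simp
    _ = κ j := by simp

/-- `(x + y)^κ` for a point `y`, as an element of `ℂ[x]^{≤κ}`. -/
noncomputable def shiftPow {m : ℕ} (κ : Fin m → ℕ) (y : Fin m → ℂ) : degreeLE κ :=
  ⟨∏ i, (X i + C (y i)) ^ κ i, by
    simpa using prod_linear_mem_degreeLE (κ := κ) (k := κ) (l := 0) (fun i => by simp) y y⟩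

/-- `x^α` as an element of `ℂ[x]^{≤κ}`, for `α ≤ κ`. -/
noncomputable def monomialLE {m : ℕ} (κ α : Fin m → ℕ) : degreeLE κ :=
  -- The `min` only makes the definition total; it has no effect for `α ≤ κ`.
  ⟨∏ i, X i ^ min (α i) (κ i), by
    simpa using prod_linear_mem_degreeLE (κ := κ) (k := fun i => min (α i) (κ i)) (l := 0)
      (fun i => by simp) 0 0⟩

/-- `(x - i)^α (x + i)^{κ - α}` as an element of `ℂ[x]^{≤κ}`, for `α ≤ κ`; the Cayley transform
turns these polynomials into monomials. -/
noncomputable def cayleyLE {m : ℕ} (κ α : Fin m → ℕ) : degreeLE κ :=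
  ⟨∏ i, ((X i + C (-Complex.I)) ^ min (α i) (κ i) * (X i + C Complex.I) ^ (κ i - α i)),
    prod_linear_mem_degreeLE (fun i => by omega) _ _⟩

theorem eval_shiftPow {m : ℕ} (κ : Fin m → ℕ) (x y : Fin m → ℂ) :
    eval x (shiftPow κ y : MvPolynomial (Fin m) ℂ) = ∏ i, (x i + y i) ^ κ i := by
  simp [shiftPow]

theorem eval_monomialLE {m : ℕ} {κ α : Fin m → ℕ} (hα : α ∈ box κ) (x : Fin m → ℂ) :
    eval x (monomialLE κ α : MvPolynomial (Fin m) ℂ) = ∏ i, x i ^ α i := by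
  rw [mem_box] at hα
  simp [monomialLE, min_eq_left (hα _)]

theorem eval_cayleyLE {m : ℕ} {κ α : Fin m → ℕ} (hα : α ∈ box κ) (x : Fin m → ℂ) :
    eval x (cayleyLE κ α : MvPolynomial (Fin m) ℂ)
      = ∏ i, ((x i - Complex.I) ^ α i * (x i + Complex.I) ^ (κ i - α i)) := by
  rw [mem_box] at hα
  simp [cayleyLE, min_eq_left (hα _), sub_eq_add_neg]

theorem degreeLE_ext {m : ℕ} {κ : Fin m → ℕ} {f g : degreeLE κ}
    (h : ∀ x, eval x (f : MvPolynomial (Fin m) ℂ) = eval x (g : MvPolynomial (Fin m) ℂ)) :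
    f = g := Subtype.ext (MvPolynomial.funext h)

theorem mem_box_of_mem_support {m : ℕ} {κ : Fin m → ℕ} (f : degreeLE κ) {d : Fin m →₀ ℕ}
    (hd : d ∈ (f : MvPolynomial (Fin m) ℂ).support) : ⇑d ∈ box κ :=
  mem_box.mpr fun i => (monomial_le_degreeOf i hd).trans (f.2 i)

theorem eq_sum_monomialLE {m : ℕ} {κ : Fin m → ℕ} (f : degreeLE κ) :
    f = ∑ d ∈ (f : MvPolynomial (Fin m) ℂ).support,
      coeff d (f : MvPolynomial (Fin m) ℂ) • monomialLE κ d := by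
  refine degreeLE_ext fun x => ?_
  rw [eval_eq']
  simp only [Submodule.coe_sum, Submodule.coe_smul, map_sum, smul_eval]
  exact sum_congr rfl fun d hd => by rw [eval_monomialLE (mem_box_of_mem_support f hd)]

theorem shiftPow_eq_sum {m : ℕ} (κ : Fin m → ℕ) (y : Fin m → ℂ) :
    shiftPow κ y = ∑ α ∈ box κ,
      (∏ i, (y i ^ (κ i - α i) * ((κ i).choose (α i) : ℂ))) • monomialLE κ α := by
  refine degreeLE_ext fun x => ?_
  rw [eval_shiftPow, prod_add_pow]
  simp only [Submodule.coe_sum, Submodule.coe_smul, map_sum, smul_eval]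
  refine sum_congr rfl fun α hα => ?_
  rw [eval_monomialLE hα, ← prod_mul_distrib]
  exact prod_congr rfl fun i _ => by ring

theorem extendToY_monomial {m : ℕ} {κ : Fin m → ℕ}
    (T : degreeLE κ →ₗ[ℂ] MvPolynomial (Fin m) ℂ) {α : Fin m → ℕ} (hα : α ∈ box κ)
    (β : Fin m → ℕ) :
    extendToY T (∏ i, (X (Sum.inl i) ^ α i * X (Sum.inr i) ^ β i))
      = rename Sum.inl (T (monomialLE κ α)) * rename Sum.inr (∏ i, X i ^ β i) := by
  have hα' := mem_box.mp hα
  set a : Fin m →₀ ℕ := Finsupp.equivFunOnFinite.symm α with ha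
  set b : Fin m →₀ ℕ := Finsupp.equivFunOnFinite.symm β with hb
  have e1 : ∀ d : Fin m →₀ ℕ, (monomial d (1 : ℂ)) = ∏ i, X i ^ d i := fun d => by
    rw [monomial_eq, C_1, one_mul, Finsupp.prod_fintype _ _ (by simp)]
  have e2 : (∏ i, (X (Sum.inl i) ^ α i * X (Sum.inr i) ^ β i) : MvPolynomial (Fin m ⊕ Fin m) ℂ)
      = basisMonomials (Fin m ⊕ Fin m) ℂ (Finsupp.sumFinsuppEquivProdFinsupp.symm (a, b)) := by
    rw [coe_basisMonomials]
    simp only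
    rw [monomial_eq, C_1, one_mul, Finsupp.prod_fintype _ _ (by simp), Fintype.prod_sum_type,
      prod_mul_distrib]
    rfl
  rw [e2, extendToY, Module.Basis.constr_basis]
  simp only [Equiv.apply_symm_apply]
  rw [dif_pos (show ∀ i, a i ≤ κ i from hα')]
  have e3 : (⟨monomial a 1, monomial_mem_degreeLE hα' 1⟩ : degreeLE κ)
      = monomialLE κ α := by
    refine degreeLE_ext fun x => ?_
    rw [eval_monomialLE hα]
    simp only [e1]
    simp [ha]
  rw [e3, e1]
  rfl

/-- `T` treats `y` as scalars, so `y` may be specialised before `T` is applied. -/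
theorem eval_symbol {m : ℕ} {κ : Fin m → ℕ} (T : degreeLE κ →ₗ[ℂ] MvPolynomial (Fin m) ℂ)
    (z : Fin m ⊕ Fin m → ℂ) :
    eval z (symbol T) = eval (z ∘ Sum.inl) (T (shiftPow κ (z ∘ Sum.inr))) := by
  rw [shiftPow_eq_sum, symbol, prod_add_pow]
  simp only [map_sum, map_smul, smul_eval]
  refine sum_congr rfl fun α hα => ?_
  have e : (∏ i, (X (Sum.inl i) ^ α i * X (Sum.inr i) ^ (κ i - α i)
        * ((κ i).choose (α i) : MvPolynomial (Fin m ⊕ Fin m) ℂ)))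
      = (∏ i, ((κ i).choose (α i) : ℂ)) •
        ∏ i, (X (Sum.inl i) ^ α i * X (Sum.inr i) ^ (κ i - α i)) := by
    rw [prod_mul_distrib, smul_eq_C_mul, mul_comm]
    simp
  rw [e, map_smul, extendToY_monomial T hα, smul_eval, map_mul, eval_rename, eval_rename,
    prod_mul_distrib]
  simp only [eval_prod, eval_pow, eval_X, Function.comp_apply]
  ring

/-- Distinct `α` carry distinct powers `y ^ (κ - α)` with nonzero binomial factors, so each `T (x ^
α)` can be read off as a coefficient in `y`. -/
theorem eq_zero_of_symbol_eq_zero {m : ℕ} {κ : Fin m → ℕ}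
    {T : degreeLE κ →ₗ[ℂ] MvPolynomial (Fin m) ℂ} (h : symbol T = 0) : T = 0 := by
  have hmon : ∀ α ∈ box κ, T (monomialLE κ α) = 0 := by
    intro α₀ hα₀
    refine MvPolynomial.funext fun x => ?_
    rw [map_zero]
    set q : MvPolynomial (Fin m) ℂ := ∑ α ∈ box κ,
      monomial (Finsupp.equivFunOnFinite.symm fun i => κ i - α i)
        ((∏ i, ((κ i).choose (α i) : ℂ)) * eval x (T (monomialLE κ α))) with hq
    have hq0 : q = 0 := by
      refine MvPolynomial.funext fun y => ?_
      have := eval_symbol T (Sum.elim x y)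
      rw [h, map_zero, Sum.elim_comp_inl, Sum.elim_comp_inr, shiftPow_eq_sum] at this
      rw [map_zero, this, hq]
      simp only [map_sum, map_smul, smul_eval, eval_monomial]
      refine sum_congr rfl fun α _ => ?_
      rw [Finsupp.prod_fintype _ _ (by simp), prod_mul_distrib]
      simp only [Finsupp.equivFunOnFinite_symm_apply_apply]
      ring
    have hc := congrArg (coeff (Finsupp.equivFunOnFinite.symm fun i => κ i - α₀ i)) hq0
    rw [hq, coeff_sum, coeff_zero, sum_eq_single α₀] at hc
    · rw [coeff_monomial, if_pos rfl] at hc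
      refine (mul_eq_zero.mp hc).resolve_left (prod_ne_zero_iff.mpr fun i _ => ?_)
      exact_mod_cast (Nat.choose_pos (mem_box.mp hα₀ i)).ne'
    · intro α hα hne
      rw [coeff_monomial, if_neg]
      intro he
      refine hne (funext fun i => ?_)
      have h1 : κ i - α i = κ i - α₀ i := congrFun (Finsupp.equivFunOnFinite.symm.injective he) i
      have h2 := mem_box.mp hα i
      have h3 := mem_box.mp hα₀ i
      omega
    · exact fun hn => absurd hα₀ hn
  refine LinearMap.ext fun f => ?_
  rw [eq_sum_monomialLE f, map_sum, LinearMap.zero_apply]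
  refine sum_eq_zero fun d hd => ?_
  rw [map_smul, hmon _ (mem_box_of_mem_support f hd), smul_zero]

/-! ### Expansion in the Cayley basis -/

theorem exists_pow_eq_sum_cayley (n : ℕ) : ∀ a ≤ n, ∃ e : ℕ → ℂ, ∀ x : ℂ,
    x ^ a = ∑ k ∈ range (n + 1), e k * ((x - Complex.I) ^ k * (x + Complex.I) ^ (n - k)) := by
  induction n with
  | zero =>
    intro a ha
    obtain rfl : a = 0 := by omega
    exact ⟨fun _ => 1, fun x => by simp⟩
  | succ n ih =>
    have step : ∀ (g : ℂ → ℂ) (p q : ℂ), (∃ e : ℕ → ℂ, ∀ x : ℂ,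
        g x = ∑ k ∈ range (n + 1), e k * ((x - Complex.I) ^ k * (x + Complex.I) ^ (n - k))) →
        ∃ e : ℕ → ℂ, ∀ x : ℂ, g x * (p * (x - Complex.I) + q * (x + Complex.I)) =
          ∑ k ∈ range (n + 2), e k * ((x - Complex.I) ^ k * (x + Complex.I) ^ (n + 1 - k)) := by
      rintro g p q ⟨e, he⟩
      -- The factor `x - I` shifts the index by one and `x + I` keeps it. The guards discard `e (0 -
      -- 1)` and `e (n + 1)`, which do not occur in the sum for `g`.
      refine ⟨fun k => (if k = 0 then 0 else p * e (k - 1)) + if k = n + 1 then 0 else q * e k,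
        fun x => ?_⟩
      simp only [add_mul, sum_add_distrib]
      rw [mul_add, he]
      congr 1
      · rw [sum_range_succ' _ (n + 1), if_pos rfl, zero_mul, add_zero, sum_mul]
        refine sum_congr rfl fun k hk => ?_
        rw [if_neg (Nat.succ_ne_zero k), Nat.add_sub_cancel, Nat.add_sub_add_right, pow_succ]
        ring
      · rw [sum_range_succ _ (n + 1), if_pos rfl, zero_mul, add_zero, sum_mul]
        refine sum_congr rfl fun k hk => ?_
        have hk' := mem_range.mp hk
        rw [if_neg (by omega), Nat.succ_sub (by omega), pow_succ]
        ring
    intro a ha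
    rcases Nat.lt_or_ge n a with h | h
    · obtain rfl : a = n + 1 := by omega
      obtain ⟨e, he⟩ := step (fun x => x ^ n) (1 / 2) (1 / 2) (ih n le_rfl)
      exact ⟨e, fun x => by rw [← he, pow_succ]; ring⟩
    -- Here `1 = (I/2) (x - I) - (I/2) (x + I)` raises the degree of the basis without changing `x ^
    -- a`.
    · obtain ⟨e, he⟩ := step (fun x => x ^ a) (Complex.I / 2) (-Complex.I / 2) (ih a h)
      refine ⟨e, fun x => ?_⟩
      rw [← he]
      linear_combination x ^ a * Complex.I_mul_I

theorem exists_eq_sum_cayleyLE {m : ℕ} {κ : Fin m → ℕ} (f : degreeLE κ) :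
    ∃ F : (Fin m → ℕ) → ℂ, f = ∑ α ∈ box κ, F α • cayleyLE κ α := by
  have hmon : ∀ d : Fin m → ℕ, ∃ F : (Fin m → ℕ) → ℂ,
      d ∈ box κ → monomialLE κ d = ∑ α ∈ box κ, F α • cayleyLE κ α := by
    intro d
    by_cases hd : d ∈ box κ
    swap
    · exact ⟨0, fun h => absurd h hd⟩
    choose e he using fun i => exists_pow_eq_sum_cayley (κ i) (d i) (mem_box.mp hd i)
    refine ⟨fun α => ∏ i, e i (α i), fun _ => degreeLE_ext fun x => ?_⟩
    rw [eval_monomialLE hd]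
    simp only [he, Submodule.coe_sum, Submodule.coe_smul, map_sum, smul_eval]
    rw [prod_univ_sum]
    refine sum_congr rfl fun α hα => ?_
    rw [eval_cayleyLE hα, ← prod_mul_distrib]
  choose E hE using hmon
  refine ⟨fun α => ∑ d ∈ (f : MvPolynomial (Fin m) ℂ).support,
    coeff d (f : MvPolynomial (Fin m) ℂ) * E d α, ?_⟩
  conv_lhs => rw [eq_sum_monomialLE f]
  simp only [sum_smul]
  rw [sum_comm]
  refine sum_congr rfl fun d hd => ?_
  rw [hE d (mem_box_of_mem_support f hd), smul_sum]
  simp only [smul_smul]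

/-! ### Sufficiency -/

theorem cayley_im_pos {z : ℂ} (hz : ‖z‖ < 1) : 0 < (Complex.I * (1 + z) / (1 - z)).im := by
  have hne : 1 - z ≠ 0 := by
    intro h
    have : z = 1 := by linear_combination -h
    simp [this] at hz
  have hpos : 0 < Complex.normSq (1 - z) := Complex.normSq_pos.mpr hne
  have h1 : Complex.normSq z < 1 := by
    rw [Complex.normSq_eq_norm_sq]; nlinarith [norm_nonneg z]
  rw [Complex.div_im]
  rw [← sub_div]
  refine div_pos ?_ hpos
  rw [Complex.normSq_apply] at h1
  simp
  nlinarith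

/-- At `w = I (1 + z) / (1 - z)` one has `w + I = 2 I / (1 - z)` and `w - I = (w + I) z`. Up to a
nonzero factor, `f` thus becomes the polynomial with coefficients `F`. -/
theorem sum_ne_zero_of_disc {m : ℕ} {κ : Fin m → ℕ} {f : degreeLE κ}
    (hf : ∀ z : Fin m → ℂ, (∀ i, 0 < (z i).im) → eval z (f : MvPolynomial (Fin m) ℂ) ≠ 0)
    {F : (Fin m → ℕ) → ℂ} (hF : f = ∑ α ∈ box κ, F α • cayleyLE κ α)
    {z : Fin m → ℂ} (hz : ∀ i, ‖z i‖ < 1) : ∑ α ∈ box κ, F α * ∏ i, z i ^ α i ≠ 0 := by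
  have hne : ∀ i, 1 - z i ≠ 0 := fun i h => by
    have h1 := hz i
    rw [show z i = 1 by linear_combination -h] at h1
    simp at h1
  have h := hf (fun i => Complex.I * (1 + z i) / (1 - z i)) fun i => cayley_im_pos (hz i)
  intro h0
  refine h ?_
  rw [hF]
  simp only [Submodule.coe_sum, Submodule.coe_smul, map_sum, smul_eval]
  have : ∀ α ∈ box κ, F α * eval (fun i => Complex.I * (1 + z i) / (1 - z i))
      (cayleyLE κ α : MvPolynomial (Fin m) ℂ)
      = (∏ i, (2 * Complex.I / (1 - z i)) ^ κ i) * (F α * ∏ i, z i ^ α i) := by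
    intro α hα
    rw [eval_cayleyLE hα, mul_left_comm, ← prod_mul_distrib]
    congr 1
    refine prod_congr rfl fun i _ => ?_
    have h1 := hne i
    have e1 : Complex.I * (1 + z i) / (1 - z i) - Complex.I
        = (2 * Complex.I / (1 - z i)) * z i := by field_simp; ring
    have e2 : Complex.I * (1 + z i) / (1 - z i) + Complex.I
        = 2 * Complex.I / (1 - z i) := by field_simp; ring
    rw [e1, e2, mul_pow, mul_right_comm, ← pow_add, Nat.add_sub_cancel' (mem_box.mp hα i)]
  rw [sum_congr rfl this, ← mul_sum, h0, mul_zero]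

/-- For `y = I (1 - z) / (1 + z)`, `(1 + z) (x + y) = z (x - I) + (x + I)`. Hence `(x + y)^κ` is, up
to a nonzero factor, the binomial generating function of the Cayley basis. -/
theorem sum_choose_cayley_ne_zero {m : ℕ} {κ : Fin m → ℕ} {Λ : degreeLE κ →ₗ[ℂ] ℂ}
    (hΛ : ∀ y : Fin m → ℂ, (∀ i, 0 < (y i).im) → Λ (shiftPow κ y) ≠ 0)
    {z : Fin m → ℂ} (hz : ∀ i, ‖z i‖ < 1) :
    ∑ α ∈ box κ, (∏ i, ((κ i).choose (α i) : ℂ)) * Λ (cayleyLE κ α) * ∏ i, z i ^ α i ≠ 0 := by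
  have hne : ∀ i, 1 + z i ≠ 0 := fun i h => by
    have h1 := hz i
    rw [show z i = -1 by linear_combination h] at h1
    simp at h1
  have key : ∑ α ∈ box κ, ((∏ i, ((κ i).choose (α i) : ℂ)) * ∏ i, z i ^ α i) • cayleyLE κ α
      = (∏ i, (1 + z i) ^ κ i) • shiftPow κ fun i => Complex.I * (1 + -z i) / (1 - -z i) := by
    refine degreeLE_ext fun x => ?_
    simp only [Submodule.coe_sum, Submodule.coe_smul, map_sum, smul_eval]
    rw [eval_shiftPow, ← prod_mul_distrib]
    have e : ∀ i, (1 + z i) ^ κ i * (x i + Complex.I * (1 + -z i) / (1 - -z i)) ^ κ i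
        = (z i * (x i - Complex.I) + (x i + Complex.I)) ^ κ i := fun i => by
      have := hne i
      rw [← mul_pow, sub_neg_eq_add]
      congr 1
      field_simp
      ring
    simp only [e]
    rw [prod_add_pow]
    refine sum_congr rfl fun α hα => ?_
    rw [eval_cayleyLE hα, ← prod_mul_distrib, ← prod_mul_distrib]
    exact prod_congr rfl fun i _ => by rw [mul_pow]; ring
  have h := congrArg Λ key
  simp only [map_sum, map_smul, smul_eq_mul] at h
  intro h0
  have h1 := hΛ (fun i => Complex.I * (1 + -z i) / (1 - -z i)) fun i =>
    cayley_im_pos (by rw [norm_neg]; exact hz i)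
  have h2 : ∏ i, (1 + z i) ^ κ i ≠ 0 := prod_ne_zero_iff.mpr fun i _ => pow_ne_zero _ (hne i)
  refine mul_ne_zero h2 h1 ?_
  rw [← h, ← h0]
  exact sum_congr rfl fun α _ => by ring

/-- Grace's theorem for the upper half-plane, with one of the two polynomials contracted by
`s ^ 2` in the disc coordinates. -/
theorem functional_ne_zero {m : ℕ} {κ : Fin m → ℕ} {Λ : degreeLE κ →ₗ[ℂ] ℂ}
    (hΛ : ∀ y : Fin m → ℂ, (∀ i, 0 < (y i).im) → Λ (shiftPow κ y) ≠ 0) {f : degreeLE κ}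
    (hf : ∀ z : Fin m → ℂ, (∀ i, 0 < (z i).im) → eval z (f : MvPolynomial (Fin m) ℂ) ≠ 0)
    {F : (Fin m → ℕ) → ℂ} (hF : f = ∑ α ∈ box κ, F α • cayleyLE κ α)
    {s : ℝ} (hs0 : 0 ≤ s) (hs1 : s < 1) :
    ∑ α ∈ box κ, (F α * ∏ i, ((s : ℂ) ^ 2) ^ α i) * Λ (cayleyLE κ α) ≠ 0 := by
  have hnorm : ∀ w : ℂ, ‖w‖ ≤ 1 → ‖(s : ℂ) * w‖ < 1 := fun w hw => by
    rw [norm_mul, Complex.norm_real, Real.norm_of_nonneg hs0]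
    nlinarith [norm_nonneg w]
  -- Scaling both arguments by `s` sends the closed disc into the open one, where nonvanishing is
  -- known. The binomials in the first factor cancel the denominators of the diagonal sum.
  have h := sum_box_diag_ne_zero m κ
    (fun α β => ((∏ i, ((κ i).choose (α i) : ℂ)) * Λ (cayleyLE κ α) * ∏ i, (s : ℂ) ^ α i) *
      (F β * ∏ i, (s : ℂ) ^ β i)) (fun x z hx hz => by
        have h1 := sum_choose_cayley_ne_zero hΛ (z := fun i => s * x i) fun i => hnorm _ (hx i)
        have h2 := sum_ne_zero_of_disc hf hF (z := fun i => s * z i) fun i => hnorm _ (hz i)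
        convert mul_ne_zero h1 h2 using 1
        rw [sum_mul_sum]
        refine sum_congr rfl fun α _ => sum_congr rfl fun β _ => ?_
        simp only [mul_pow, prod_mul_distrib]
        ring)
  convert h using 1
  refine sum_congr rfl fun α hα => ?_
  have hc : ∏ i, ((κ i).choose (α i) : ℂ) ≠ 0 := prod_ne_zero_iff.mpr fun i _ => by
    exact_mod_cast (Nat.choose_pos (mem_box.mp hα i)).ne'
  have e : ∏ i, ((s : ℂ) ^ 2) ^ α i = (∏ i, (s : ℂ) ^ α i) * ∏ i, (s : ℂ) ^ α i := by
    rw [← prod_mul_distrib]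
    exact prod_congr rfl fun i _ => by ring
  rw [e]
  field_simp

open Filter Topology in
-- The Hurwitz step, along the complex line from `x₀` to an arbitrary `x₁`. For `s < 1` the
-- contracted polynomial `p s` has no zero with `|t| < ρ`, so its value at `1` is bounded by its
-- value at `0`, uniformly in `s`; then `s → 1`.
theorem eval_eq_zero_of_eval_eq_zero {m : ℕ} {κ : Fin m → ℕ}
    {T : degreeLE κ →ₗ[ℂ] MvPolynomial (Fin m) ℂ}
    (hT : ∀ x y : Fin m → ℂ, (∀ i, 0 < (x i).im) → (∀ i, 0 < (y i).im) →
      eval x (T (shiftPow κ y)) ≠ 0) {f : degreeLE κ}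
    (hf : ∀ z : Fin m → ℂ, (∀ i, 0 < (z i).im) → eval z (f : MvPolynomial (Fin m) ℂ) ≠ 0)
    {x₀ x₁ : Fin m → ℂ} (hx₀ : ∀ i, 0 < (x₀ i).im) (h0 : eval x₀ (T f) = 0) :
    eval x₁ (T f) = 0 := by
  obtain ⟨F, hF⟩ := exists_eq_sum_cayleyLE f
  set q : (Fin m → ℕ) → Polynomial ℂ := fun α =>
    aeval (fun i => Polynomial.C (x₀ i) + Polynomial.X * Polynomial.C (x₁ i - x₀ i))
      (T (cayleyLE κ α)) with hq
  have hqe : ∀ α t, (q α).eval t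
      = eval (fun i => x₀ i + t * (x₁ i - x₀ i)) (T (cayleyLE κ α)) := fun α t => by
    rw [← Polynomial.coe_evalRingHom]
    simp only [hq]
    rw [ aeval_def, hom_eval₂, MvPolynomial.eval, coe_eval₂Hom]
    congr 1
    · ext; simp
    · ext i; simp
  set p : ℝ → Polynomial ℂ := fun s =>
    ∑ α ∈ box κ, Polynomial.C (F α * ∏ i, ((s : ℂ) ^ 2) ^ α i) * q α with hp
  have hpe : ∀ s t, (p s).eval t
      = ∑ α ∈ box κ, (F α * ∏ i, ((s : ℂ) ^ 2) ^ α i) * (q α).eval t := fun s t => by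
    simp only [hp, Polynomial.eval_finsetSum, Polynomial.eval_mul, Polynomial.eval_C]
  have hdeg : ∀ s, (p s).natDegree ≤ (box κ).sup fun α => (q α).natDegree := fun s => by
    refine Polynomial.natDegree_sum_le_of_forall_le _ _ fun α hα => ?_
    exact (Polynomial.natDegree_C_mul_le _ _).trans (le_sup (f := fun α => (q α).natDegree) hα)
  have hρ : ∃ ρ > 0, ∀ t : ℂ, ‖t‖ < ρ → ∀ i, 0 < (x₀ i + t * (x₁ i - x₀ i)).im := by
    have : ∀ᶠ t : ℂ in 𝓝 0, ∀ i, 0 < (x₀ i + t * (x₁ i - x₀ i)).im := by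
      refine eventually_all.mpr fun i => ?_
      have hc : Continuous fun t : ℂ => (x₀ i + t * (x₁ i - x₀ i)).im := by fun_prop
      exact hc.continuousAt.eventually_mem (isOpen_Ioi.mem_nhds (by simpa using hx₀ i))
    obtain ⟨ρ, hρ, h⟩ := Metric.eventually_nhds_iff.mp this
    exact ⟨ρ, hρ, fun t ht => h (by simpa using ht)⟩
  obtain ⟨ρ, hρ0, hρ⟩ := hρ
  set D := (box κ).sup fun α => (q α).natDegree
  have hbound : ∀ s : ℝ, 0 ≤ s → s < 1 →
      ‖(p s).eval 1‖ ≤ ‖(p s).eval 0‖ * (1 + 1 / ρ) ^ D := fun s hs0 hs1 => by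
    refine norm_eval_le_of_ne_zero (hdeg s) hρ0 fun t ht => ?_
    rw [hpe]
    simp only [hqe]
    exact functional_ne_zero
      (Λ := (MvPolynomial.aeval fun i => x₀ i + t * (x₁ i - x₀ i)).toLinearMap ∘ₗ T)
      (fun y hy => hT _ y (hρ t ht) hy) hf hF hs0 hs1
  have hcont : ∀ t, Continuous fun s => (p s).eval t := fun t => by
    simp only [hpe]
    fun_prop
  have hlim : ‖(p 1).eval 1‖ ≤ ‖(p 1).eval 0‖ * (1 + 1 / ρ) ^ D := by
    refine le_of_tendsto_of_tendsto (b := 𝓝[<] (1 : ℝ))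
      ((hcont 1).norm.tendsto 1 |>.mono_left nhdsWithin_le_nhds)
      (((hcont 0).norm.mul continuous_const).tendsto 1 |>.mono_left nhdsWithin_le_nhds) ?_
    filter_upwards [Ico_mem_nhdsLT (show (0 : ℝ) < 1 by norm_num)] with s hs
    exact hbound s hs.1 hs.2
  have hone : ∀ t, (p 1).eval t = eval (fun i => x₀ i + t * (x₁ i - x₀ i)) (T f) := fun t => by
    rw [hpe, hF]
    simp [hqe, smul_eval]
  rw [hone, hone] at hlim
  simpa [h0] using hlim

theorem isStable_of_isStable_symbol {m : ℕ} {κ : Fin m → ℕ}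
    {T : degreeLE κ →ₗ[ℂ] MvPolynomial (Fin m) ℂ} (hT : IsStable (symbol T)) (f : degreeLE κ)
    (hf : IsStable (f : MvPolynomial (Fin m) ℂ)) : IsStable (T f) := by
  rcases hT with hT | hT
  · exact Or.inl (by rw [eq_zero_of_symbol_eq_zero hT, LinearMap.zero_apply])
  rcases hf with hf | hf
  · exact Or.inl (by rw [show f = 0 from Subtype.ext hf, map_zero])
  refine or_iff_not_imp_right.mpr fun h => ?_
  push Not at h
  obtain ⟨x₀, hx₀, h0⟩ := h
  refine MvPolynomial.funext fun x₁ => ?_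
  rw [map_zero]
  refine eval_eq_zero_of_eval_eq_zero (fun x y hx hy => ?_) hf hx₀ h0
  have := hT (Sum.elim x y) (Sum.rec hx hy)
  rwa [eval_symbol, Sum.elim_comp_inl, Sum.elim_comp_inr] at this

/-! ### Necessity -/

theorem norm_eval_le_shiftPow {m : ℕ} {κ : Fin m → ℕ} {y : Fin m → ℂ} (hy : ∀ i, 0 < (y i).im)
    (f : degreeLE κ) : ∃ K : ℝ, 0 ≤ K ∧ ∀ z : Fin m → ℂ, (∀ i, 0 < (z i).im) →
      ‖eval z (f : MvPolynomial (Fin m) ℂ)‖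
        ≤ K * ‖eval z (shiftPow κ y : MvPolynomial (Fin m) ℂ)‖ := by
  -- Since `|z + y| ≥ Im y`, this constant makes `B |z + y|` at least both `1` and `|z|`, so its
  -- `κ`-th power dominates every `|z| ^ d` with `d ≤ κ`.
  set B : Fin m → ℝ := fun i => 1 + (‖y i‖ + 1) / (y i).im with hB
  have hB0 : ∀ i, 0 ≤ B i := fun i => by have := hy i; positivity
  refine ⟨∑ d ∈ (f : MvPolynomial (Fin m) ℂ).support,
    ‖coeff d (f : MvPolynomial (Fin m) ℂ)‖ * ∏ i, B i ^ κ i,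
    sum_nonneg fun d _ => mul_nonneg (norm_nonneg _) (prod_nonneg fun i _ => pow_nonneg (hB0 i) _),
    fun z hz => ?_⟩
  rw [eval_eq', sum_mul]
  refine (norm_sum_le _ _).trans (sum_le_sum fun d hd => ?_)
  rw [norm_mul, mul_assoc]
  refine mul_le_mul_of_nonneg_left ?_ (norm_nonneg _)
  rw [eval_shiftPow, norm_prod, norm_prod, ← prod_mul_distrib]
  refine prod_le_prod (fun i _ => norm_nonneg _) fun i _ => ?_
  have hdi := mem_box.mp (mem_box_of_mem_support f hd) i
  rw [norm_pow, norm_pow, ← mul_pow]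
  have hyi := hy i
  have him : (y i).im ≤ ‖z i + y i‖ := by
    have h1 := Complex.im_le_norm (z i + y i)
    have h2 := hz i
    rw [Complex.add_im] at h1
    linarith
  have h1 : (‖y i‖ + 1) ≤ (‖y i‖ + 1) / (y i).im * ‖z i + y i‖ := by
    rw [div_mul_eq_mul_div, le_div_iff₀ hyi]
    exact mul_le_mul_of_nonneg_left him (by positivity)
  have h2 : B i * ‖z i + y i‖ = ‖z i + y i‖ + (‖y i‖ + 1) / (y i).im * ‖z i + y i‖ := by
    rw [hB]; ring
  have h3 : ‖z i‖ ≤ ‖z i + y i‖ + ‖y i‖ := by simpa using norm_sub_le (z i + y i) (y i)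
  have h4 : ‖z i‖ ≤ B i * ‖z i + y i‖ := by linarith
  have h5 : 1 ≤ B i * ‖z i + y i‖ := by
    linarith [norm_nonneg (z i + y i), norm_nonneg (y i)]
  exact (pow_le_pow_left₀ (norm_nonneg _) h4 _).trans (pow_le_pow_right₀ h5 hdi)

theorem eval_shiftPow_ne_zero {m : ℕ} (κ : Fin m → ℕ) {y z : Fin m → ℂ}
    (hy : ∀ i, 0 < (y i).im) (hz : ∀ i, 0 < (z i).im) :
    eval z (shiftPow κ y : MvPolynomial (Fin m) ℂ) ≠ 0 := by
  rw [eval_shiftPow]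
  refine prod_ne_zero_iff.mpr fun i _ => pow_ne_zero _ fun h => ?_
  have := congrArg Complex.im h
  rw [Complex.add_im, Complex.zero_im] at this
  linarith [hy i, hz i]

theorem exists_isStable_shiftPow_add_smul {m : ℕ} {κ : Fin m → ℕ} {y : Fin m → ℂ}
    (hy : ∀ i, 0 < (y i).im) (f : degreeLE κ) :
    ∃ ε : ℂ, ε ≠ 0 ∧ IsStable ((shiftPow κ y + ε • f : degreeLE κ) : MvPolynomial (Fin m) ℂ) := by
  obtain ⟨K, hK0, hK⟩ := norm_eval_le_shiftPow hy f
  have hK1 : (0 : ℝ) < K + 1 := by linarith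
  -- With this `ε`, `|ε f| ≤ K/(K+1) |(z + y)^κ| < |(z + y)^κ|`, so the sum cannot vanish.
  refine ⟨((K + 1)⁻¹ : ℝ), by exact_mod_cast (inv_pos.mpr hK1).ne', Or.inr fun z hz h => ?_⟩
  have hne := norm_pos_iff.mpr (eval_shiftPow_ne_zero κ hy hz)
  rw [Submodule.coe_add, Submodule.coe_smul, map_add, smul_eval, add_eq_zero_iff_eq_neg] at h
  have h1 := congrArg norm h
  rw [norm_neg, norm_mul, Complex.norm_real, Real.norm_of_nonneg (inv_pos.mpr hK1).le,
    eq_inv_mul_iff_mul_eq₀ hK1.ne'] at h1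
  have := hK z hz
  linarith

theorem IsStable.smul {σ : Type*} {p : MvPolynomial σ ℂ} (hp : IsStable p) (c : ℂ) :
    IsStable (c • p) := by
  rcases eq_or_ne c 0 with rfl | hc
  · exact Or.inl (zero_smul _ _)
  rcases hp with rfl | hp
  · exact Or.inl (smul_zero _)
  · exact Or.inr fun z hz => by rw [smul_eval]; exact mul_ne_zero hc (hp z hz)

/-- A linear map with stable values has rank at most one. -/
theorem exists_eq_smul_of_forall_isStable {V σ : Type*} [AddCommGroup V] [Module ℂ V]
    {T : V →ₗ[ℂ] MvPolynomial σ ℂ} (h : ∀ f, IsStable (T f)) :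
    ∃ (η : V →ₗ[ℂ] ℂ) (p : MvPolynomial σ ℂ), IsStable p ∧ ∀ f, T f = η f • p := by
  by_cases hT : ∀ f, T f = 0
  · exact ⟨0, 0, Or.inl rfl, fun f => by simp [hT f]⟩
  push Not at hT
  obtain ⟨f₀, hf₀⟩ := hT
  set z₀ : σ → ℂ := fun _ => Complex.I
  have hz₀ : ∀ i, 0 < (z₀ i).im := fun i => by simp [z₀]
  have hne : eval z₀ (T f₀) ≠ 0 := (h f₀).resolve_left hf₀ z₀ hz₀
  refine ⟨(eval z₀ (T f₀))⁻¹ • (MvPolynomial.aeval z₀).toLinearMap ∘ₗ T, T f₀, h f₀, fun f => ?_⟩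
  have e : ((eval z₀ (T f₀))⁻¹ • (MvPolynomial.aeval z₀).toLinearMap ∘ₗ T) f
      = (eval z₀ (T f₀))⁻¹ * eval z₀ (T f) := rfl
  rw [e]
  -- This `c` makes `T (f - c • f₀)` vanish at `z₀`; being stable, it must be zero.
  set c := (eval z₀ (T f₀))⁻¹ * eval z₀ (T f) with hc
  have h0 : eval z₀ (T (f - c • f₀)) = 0 := by
    rw [map_sub, map_smul, map_sub, smul_eval, hc]
    field_simp
    ring
  have := (h (f - c • f₀)).resolve_right fun hcon => hcon z₀ hz₀ h0
  rwa [map_sub, map_smul, sub_eq_zero] at this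

end StablePoly

theorem theorem5p2 (m : ℕ) (κ : Fin m → ℕ)
    (T : StablePoly.degreeLE κ →ₗ[ℂ] MvPolynomial (Fin m) ℂ) :
    (∀ f : StablePoly.degreeLE κ,
        StablePoly.IsStable (f : MvPolynomial (Fin m) ℂ) → StablePoly.IsStable (T f)) ↔
      (∃ (η : StablePoly.degreeLE κ →ₗ[ℂ] ℂ) (p : MvPolynomial (Fin m) ℂ),
          StablePoly.IsStable p ∧ ∀ f, T f = η f • p) ∨
        StablePoly.IsStable (StablePoly.symbol T) := by
  constructor
  · intro hT
    refine or_iff_not_imp_right.mpr fun hs => ?_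
    rw [StablePoly.IsStable, not_or] at hs
    obtain ⟨-, hs⟩ := hs
    push Not at hs
    obtain ⟨z, hz, h0⟩ := hs
    rw [StablePoly.eval_symbol] at h0
    have hy : ∀ i, 0 < ((z ∘ Sum.inr) i).im := fun i => hz (Sum.inr i)
    -- The image is stable yet vanishes at a point of the upper half-plane.
    have hzero : T (StablePoly.shiftPow κ (z ∘ Sum.inr)) = 0 :=
      (hT _ (Or.inr fun x hx => StablePoly.eval_shiftPow_ne_zero κ hy hx)).resolve_right
        fun h => h _ (fun i => hz (Sum.inl i)) h0
    refine StablePoly.exists_eq_smul_of_forall_isStable fun f => ?_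
    obtain ⟨ε, hε, hst⟩ := StablePoly.exists_isStable_shiftPow_add_smul hy f
    -- As `T` kills the unperturbed power, only `ε • T f` remains.
    have h1 := (hT _ hst).smul ε⁻¹
    rwa [map_add, hzero, zero_add, map_smul, smul_smul, inv_mul_cancel₀ hε, one_smul] at h1
  · rintro (⟨η, p, hp, h⟩ | hs) f hf
    · rw [h f]
      exact hp.smul _
    · exact StablePoly.isStable_of_isStable_symbol hs f hf
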